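/- Let $0\le k\le n$ be integers, let $Q^n=[0,1]^n\subset\mathbb R^n$, and let $\{X_i\}$ be a family of subsets of $Q^n$ such that either all $X_i$ are open in $Q^n$ (the family being finite or infinite), or the family is finite and all $X_i$ are closed. Suppose that no $X_i$ meets two opposite facets of $Q^n$, i.e. for every $i$ and every $j\in\{1,\dots,n\}$ the set $X_i$ is disjoint from at least one of the facets $\{x\in Q^n: x_j=0\}$ and $\{x\in Q^n: x_j=1\}$. Suppose further that the covering multiplicity of the family is at most $k$, i.e. no point of $Q^n$ belongs to $X_i$ for more than $k$ indices $i$. Then there exist a connected component $Z$ of $Q^n\setminus\bigcup_i X_i$ and a $k$-dimensional coordinate subspace $L\subseteq\mathbb R^n$ (a subspace spanned by $k$ of the standard basis vectors) such that $Z$ intersects every $k$-dimensional face of $Q^n$ parallel to $L$. -/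

import Mathlib

/-- The unit cube `[0,1]^n` in `ℝ^n`. -/
def unitCube (n : ℕ) : Set (Fin n → ℝ) := Set.Icc 0 1

/-- The facet `x_j = 0` of the unit cube. -/
def lowerFacet {n : ℕ} (j : Fin n) : Set (Fin n → ℝ) := {x ∈ unitCube n | x j = 0}

/-- The facet `x_j = 1` of the unit cube, opposite to `lowerFacet j`. -/
def upperFacet {n : ℕ} (j : Fin n) : Set (Fin n → ℝ) := {x ∈ unitCube n | x j = 1}

/-- `F` is a nonempty face of the unit cube: the coordinates outside some set `I` are fixed, each
to be `0` or `1`, and those in `I` range freely over `[0,1]`. -/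
def IsCubeFace {n : ℕ} (F : Set (Fin n → ℝ)) : Prop :=
  ∃ (I : Finset (Fin n)) (v : Fin n → ℝ), (∀ j, v j = 0 ∨ v j = 1) ∧
    F = {x ∈ unitCube n | ∀ j, j ∉ I → x j = v j}

/-- `L` is a coordinate subspace of `ℝ^n`: it is spanned by some of the standard basis vectors. -/
def IsCoordinateSubspace {n : ℕ} (L : Submodule ℝ (Fin n → ℝ)) : Prop :=
  ∃ I : Finset (Fin n), L = Submodule.span ℝ ((fun j => Pi.single j (1 : ℝ)) '' (I : Set (Fin n)))

/-- `Z` is a connected component of the subspace `S`. -/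
def IsConnectedComponentOf {α : Type*} [TopologicalSpace α] (Z S : Set α) : Prop :=
  ∃ x ∈ S, Z = connectedComponentIn S x

/-- `S` is open in the subspace topology of the unit cube. -/
def IsOpenInCube {n : ℕ} (S : Set (Fin n → ℝ)) : Prop :=
  ∃ U : Set (Fin n → ℝ), IsOpen U ∧ S = unitCube n ∩ U

/-! Take `L` spanned by the first `k` basis vectors. In the open case, suppose that every component
of the compact complement `W` misses some face parallel to `L`, given by a 0/1 choice of the last
coordinates. Components of `W` are intersections of clopen sets, so this choice can be made locally
constant on `W` (`exists_isLocallyConstant_notMem`), and its coordinates extend to continuous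
functions `e j` on the whole space. The set `T` where `x j = e j x` for all `j ≥ k` then avoids `W`,
hence is covered by the family.

Since the multiplicity is at most `k`, the cover of `T` regroups into `k` levels, one for each
remaining coordinate. On level `c` a function `φ c` takes the value 0 near sets missing the facet `x
c = 0`, and 1 near sets missing the opposite one (`exists_separating_functions`). By Brouwer, the
map with coordinates `φ c` and `e j` has a fixed point. It lies in `T`, and for some `c` it lies in
a set and on a facet which that set misses: a contradiction. Closed families are thickened to open
ones. -/

/-- In characteristic two, a symmetric function sums to zero over the ordered pairs of distinct
elements of a finite set. -/
theorem sum_sum_erase_eq_zero {α : Type*} [DecidableEq α] (s : Finset α) (g : α → α → ZMod 2)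
    (hg : ∀ a b, g a b = g b a) : ∑ a ∈ s, ∑ b ∈ s.erase a, g a b = 0 := by
  induction s using Finset.induction_on with
  | empty => simp
  | insert x s hx ih =>
    rw [Finset.sum_insert hx, Finset.erase_insert hx]
    have h : ∀ a ∈ s, ∑ b ∈ (insert x s).erase a, g a b = g a x + ∑ b ∈ s.erase a, g a b := by
      intro a ha
      have hxa : x ≠ a := fun h => hx (h ▸ ha)
      rw [Finset.erase_insert_of_ne hxa, Finset.sum_insert (by simp [hx])]
    rw [Finset.sum_congr rfl h, Finset.sum_add_distrib, ih, add_zero,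
      Finset.sum_congr rfl (fun a _ => hg x a)]
    exact CharTwo.add_self_eq_zero _

/-! ### Kuhn's lemma via cup products modulo two -/

section Kuhn

variable {ι : Type*} [DecidableEq ι]

/-- The lattice point next to `v` in direction `r`. -/
def latticeStep (v : ι → ℕ) (r : ι) : ι → ℕ := Function.update v r (v r + 1)

theorem latticeStep_same (v : ι → ℕ) (r : ι) : latticeStep v r r = v r + 1 := by
  simp [latticeStep]

theorem latticeStep_of_ne (v : ι → ℕ) {r s : ι} (h : s ≠ r) : latticeStep v r s = v s := by
  simp [latticeStep, h]

theorem latticeStep_comm (v : ι → ℕ) (r s : ι) :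
    latticeStep (latticeStep v r) s = latticeStep (latticeStep v s) r := by
  rcases eq_or_ne r s with rfl | h
  · rfl
  · ext i
    simp only [latticeStep, Function.update_apply]
    split_ifs <;> simp_all

theorem latticeStep_update (v : ι → ℕ) (r : ι) (x : ℕ) :
    latticeStep (Function.update v r x) r = Function.update v r (x + 1) := by
  simp [latticeStep]

/-- The cup product modulo two of the coboundaries of the labels `a i`, for `i` running through the
list, evaluated on the lattice cube with lowest vertex `v` and edge directions `R`: a sum over the
monotone edge paths through the cube. -/
def cubePathSum (a : ι → (ι → ℕ) → ZMod 2) : List ι → (ι → ℕ) → Finset ι → ZMod 2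
  | [], _, R => if R = ∅ then 1 else 0
  | i :: l, v, R =>
    ∑ r ∈ R, (a i (latticeStep v r) + a i v) * cubePathSum a l (latticeStep v r) (R.erase r)

/-- The cocycle condition for a product of coboundaries: two successive steps can be taken in either
order, so such terms cancel in pairs. -/
theorem cubePathSum_closed (a : ι → (ι → ℕ) → ZMod 2) (l : List ι) (v : ι → ℕ) (R : Finset ι) :
    ∑ r ∈ R, cubePathSum a l (latticeStep v r) (R.erase r)
      = ∑ r ∈ R, cubePathSum a l v (R.erase r) := by
  induction l generalizing v R with
  | nil => simp [cubePathSum]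
  | cons i l ih =>
    simp only [cubePathSum, add_mul, Finset.sum_add_distrib]
    have h1 : ∑ r ∈ R, ∑ s ∈ R.erase r, a i (latticeStep (latticeStep v r) s) *
        cubePathSum a l (latticeStep (latticeStep v r) s) ((R.erase r).erase s) = 0 := by
      apply sum_sum_erase_eq_zero R (fun r s => a i (latticeStep (latticeStep v r) s) *
        cubePathSum a l (latticeStep (latticeStep v r) s) ((R.erase r).erase s))
      intro r s
      simp only [latticeStep_comm v r s, Finset.erase_right_comm (a := r) (b := s)]
    have h2 : ∑ r ∈ R, ∑ s ∈ R.erase r, a i v *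
        cubePathSum a l (latticeStep v s) ((R.erase r).erase s) = 0 := by
      simp only [← Finset.mul_sum, ih]
      rw [sum_sum_erase_eq_zero R (fun r s => cubePathSum a l v ((R.erase r).erase s)), mul_zero]
      intro r s
      simp only [Finset.erase_right_comm (a := r) (b := s)]
    rw [h1, h2, zero_add, add_zero]
    have h3 : ∑ r ∈ R, ∑ s ∈ R.erase r, a i (latticeStep v s) *
        cubePathSum a l (latticeStep v s) ((R.erase r).erase s) =
        ∑ s ∈ R, ∑ r ∈ R.erase s, a i (latticeStep v s) *
        cubePathSum a l (latticeStep v s) ((R.erase s).erase r) := by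
      rw [Finset.sum_comm' (t' := R) (s' := fun s => R.erase s)]
      · simp only [Finset.erase_right_comm]
      · intro x y
        simp only [Finset.mem_erase]
        tauto
    rw [h3]
    refine Finset.sum_congr rfl fun r _ => ?_
    rw [← Finset.mul_sum, ← Finset.mul_sum, ih]

/-- As the tail product `z` is a cocycle, `δa ∪ z = δ(a ∪ z)`; in this exact form the sum over a box
telescopes. -/
theorem cubePathSum_cons (a : ι → (ι → ℕ) → ZMod 2) (i : ι) (l : List ι) (v : ι → ℕ)
    (R : Finset ι) :
    cubePathSum a (i :: l) v R =
      ∑ r ∈ R, (a i (latticeStep v r) * cubePathSum a l (latticeStep v r) (R.erase r)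
        + a i v * cubePathSum a l v (R.erase r)) := by
  simp only [cubePathSum, add_mul, Finset.sum_add_distrib, ← Finset.mul_sum, cubePathSum_closed]

/-- Paths inside a facet normal to `r` never move coordinate `r`, so the factor coming from label
`r` vanishes. -/
theorem cubePathSum_eq_zero {a : ι → (ι → ℕ) → ZMod 2} {r : ι} {x : ℕ} {y : ZMod 2}
    (ha : ∀ v, v r = x → a r v = y) {l : List ι} (hl : r ∈ l) {v : ι → ℕ} (hv : v r = x)
    {R : Finset ι} (hR : r ∉ R) : cubePathSum a l v R = 0 := by
  induction l generalizing v R with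
  | nil => simp at hl
  | cons i l ih =>
    refine Finset.sum_eq_zero fun s hs => ?_
    have hv' : latticeStep v s r = x := by
      rw [latticeStep_of_ne v (ne_of_mem_of_not_mem hs hR).symm, hv]
    rcases List.mem_cons.1 hl with rfl | hl
    · rw [ha _ hv, ha _ hv', CharTwo.add_self_eq_zero, zero_mul]
    · rw [ih hl hv' (fun h => hR (Finset.mem_of_mem_erase h)), mul_zero]

theorem exists_ne_of_cubePathSum_ne_zero {a : ι → (ι → ℕ) → ZMod 2} {l : List ι} {v : ι → ℕ}
    {R : Finset ι} (h : cubePathSum a l v R ≠ 0) {i : ι} (hi : i ∈ l) :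
    ∃ w w' : ι → ℕ, (∀ j, v j ≤ w j ∧ w j ≤ v j + 1) ∧ (∀ j, v j ≤ w' j ∧ w' j ≤ v j + 1) ∧
      a i w ≠ a i w' := by
  -- The induction needs the sharper bound: only directions still in `R` may move.
  suffices ∃ w w' : ι → ℕ, (∀ j, v j ≤ w j ∧ w j ≤ v j + if j ∈ R then 1 else 0) ∧
      (∀ j, v j ≤ w' j ∧ w' j ≤ v j + if j ∈ R then 1 else 0) ∧ a i w ≠ a i w' by
    obtain ⟨w, w', hw, hw', hne⟩ := this
    refine ⟨w, w', fun j => ⟨(hw j).1, (hw j).2.trans ?_⟩,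
      fun j => ⟨(hw' j).1, (hw' j).2.trans ?_⟩, hne⟩ <;> split_ifs <;> omega
  induction l generalizing v R with
  | nil => simp at hi
  | cons i' l ih =>
    obtain ⟨r, hr, hne⟩ := Finset.exists_ne_zero_of_sum_ne_zero h
    have key : ∀ j, v j ≤ latticeStep v r j ∧
        (latticeStep v r j + if j ∈ R.erase r then 1 else 0) = v j + if j ∈ R then 1 else 0 := by
      intro j
      rcases eq_or_ne j r with rfl | hj
      · simp [latticeStep_same, hr]
      · simp [latticeStep_of_ne v hj, hj]
    rcases List.mem_cons.1 hi with rfl | hi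
    · refine ⟨latticeStep v r, v, fun j => ⟨(key j).1, ?_⟩, fun j => ⟨le_rfl, by omega⟩, ?_⟩
      · have := (key j).2
        omega
      · intro heq
        rw [heq, CharTwo.add_self_eq_zero, zero_mul] at hne
        exact hne rfl
    · obtain ⟨w, w', hw, hw', hww⟩ := ih (right_ne_zero_of_mul hne) hi
      refine ⟨w, w', fun j => ?_, fun j => ?_, hww⟩
      · have := key j
        have := hw j
        omega
      · have := key j
        have := hw' j
        omega

variable [Fintype ι]

/-- The lowest vertices of the unit lattice cubes with edge directions `R` in the face
`v i = m`, `i ∉ R`, of the lattice cube of side `m`. -/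
def latticeBox (m : ℕ) (R : Finset ι) : Finset (ι → ℕ) :=
  Fintype.piFinset fun i => if i ∈ R then Finset.range m else {m}

theorem sum_latticeBox {M : Type*} [AddCommMonoid M] {m : ℕ} {R : Finset ι} {r : ι} (hr : r ∈ R)
    (g : (ι → ℕ) → M) : ∑ v ∈ latticeBox m R, g v =
      ∑ v ∈ latticeBox m (R.erase r), ∑ x ∈ Finset.range m, g (Function.update v r x) := by
  rw [← Finset.sum_product']
  symm
  refine Finset.sum_bij' (fun p _ => Function.update p.1 r p.2)
    (fun v _ => (Function.update v r m, v r)) ?_ ?_ ?_ ?_ ?_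
  · rintro ⟨v, x⟩ h
    simp only [Finset.mem_product, latticeBox, Fintype.mem_piFinset] at h ⊢
    intro j
    rcases eq_or_ne j r with rfl | hj
    · simpa [hr] using h.2
    · simpa [hj] using h.1 j
  · intro v h
    simp only [Finset.mem_product, latticeBox, Fintype.mem_piFinset] at h ⊢
    refine ⟨fun j => ?_, by simpa [hr] using h r⟩
    rcases eq_or_ne j r with rfl | hj
    · simp
    · simpa [hj] using h j
  · rintro ⟨v, x⟩ h
    simp only [Finset.mem_product, latticeBox, Fintype.mem_piFinset] at h
    have := h.1 r
    simp at this
    simp [← this]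
  · intro v h
    simp
  · intro p h
    rfl

/-- Stokes' formula in direction `r`: interior facets cancel by telescoping. -/
theorem sum_latticeBox_coboundary {m : ℕ} {R : Finset ι} {r : ι} (hr : r ∈ R)
    (g : (ι → ℕ) → ZMod 2) : ∑ v ∈ latticeBox m R, (g (latticeStep v r) + g v) =
      ∑ v ∈ latticeBox m (R.erase r), (g v + g (Function.update v r 0)) := by
  rw [sum_latticeBox hr]
  refine Finset.sum_congr rfl fun v hv => ?_
  have hvr : v r = m := by
    have := Fintype.mem_piFinset.1 hv r
    simpa using this
  simp only [latticeStep_update, ← CharTwo.sub_eq_add]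
  rw [Finset.sum_range_sub (fun x => g (Function.update v r x)), ← hvr, Function.update_eq_self]

theorem sum_cubePathSum {m : ℕ} {a : ι → (ι → ℕ) → ZMod 2} (h0 : ∀ i v, v i = 0 → a i v = 0)
    (hm : ∀ i v, v i = m → a i v = 1) {l : List ι} (hl : l.Nodup) :
    ∑ v ∈ latticeBox m l.toFinset, cubePathSum a l v l.toFinset = 1 := by
  induction l with
  | nil => simp [latticeBox, cubePathSum]
  | cons i l ih =>
    obtain ⟨hil, hl⟩ := List.nodup_cons.1 hl
    have her : (i :: l).toFinset.erase i = l.toFinset := by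
      simp [List.toFinset_cons, hil]
    simp only [cubePathSum_cons]
    rw [Finset.sum_comm, Finset.sum_congr rfl fun r hr => sum_latticeBox_coboundary hr
      (fun v => a i v * cubePathSum a l v ((i :: l).toFinset.erase r)),
      -- Only the facet `v i = m` contributes, and it carries the sum of one dimension less. On
      -- facets normal to `r ≠ i`, label `r` is constant.
      Finset.sum_eq_single i]
    · rw [her, ← ih hl]
      refine Finset.sum_congr rfl fun v hv => ?_
      have hvi : v i = m := by
        have := Fintype.mem_piFinset.1 hv i
        simpa [hil] using this
      rw [hm i v hvi, h0 i (Function.update v i 0) (by simp)]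
      simp
    · intro r hr hri
      have hrl : r ∈ l := by simpa [hri] using hr
      refine Finset.sum_eq_zero fun v hv => ?_
      have hvr : v r = m := by
        have := Fintype.mem_piFinset.1 hv r
        simpa using this
      rw [cubePathSum_eq_zero (hm r) hrl hvr (by simp),
        cubePathSum_eq_zero (h0 r) hrl (v := Function.update v r 0) (by simp) (by simp)]
      simp
    · simp

/-- Kuhn's lemma: if `a i` is `0` on the facet `v i = 0` and `1` on the facet `v i = m` of a lattice
cube, then on some unit lattice cube no `a i` is constant. -/
theorem kuhn_lemma {m : ℕ} {a : ι → (ι → ℕ) → ZMod 2} (h0 : ∀ i v, v i = 0 → a i v = 0)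
    (hm : ∀ i v, v i = m → a i v = 1) :
    ∃ v : ι → ℕ, (∀ j, v j < m) ∧ ∀ i, ∃ w w' : ι → ℕ, (∀ j, v j ≤ w j ∧ w j ≤ v j + 1) ∧
      (∀ j, v j ≤ w' j ∧ w' j ≤ v j + 1) ∧ a i w ≠ a i w' := by
  have h := sum_cubePathSum h0 hm (Finset.nodup_toList (Finset.univ : Finset ι))
  obtain ⟨v, hv, hne⟩ := Finset.exists_ne_zero_of_sum_ne_zero (h.trans_ne one_ne_zero)
  refine ⟨v, fun j => ?_, fun i => exists_ne_of_cubePathSum_ne_zero hne (by simp)⟩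
  simpa using Fintype.mem_piFinset.1 hv j

/-! ### Brouwer's fixed point theorem -/

/-- Brouwer's fixed point theorem for the unit cube. -/
theorem exists_fixed_point_of_mem_Icc {f : (ι → ℝ) → ι → ℝ} (hf : Continuous f)
    (hmem : ∀ x, f x ∈ Set.Icc 0 1) : ∃ x, f x = x := by
  classical
  have hK : IsCompact (Set.Icc (0 : ι → ℝ) 1) := isCompact_Icc
  obtain ⟨x, hx, hmin⟩ := hK.exists_isMinOn ⟨0, by simp⟩
    (f := fun x => dist (f x) x) (by fun_prop)
  by_contra! hne
  have hpos : 0 < dist (f x) x := dist_pos.2 (hne x)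
  set ε := dist (f x) x / 2 with hε
  have huc := hK.uniformContinuousOn_of_continuous (f := fun x => f x - x) (by fun_prop)
  obtain ⟨δ, hδ, hfδ⟩ := Metric.uniformContinuousOn_iff.1 huc ε (by positivity)
  obtain ⟨m, hm⟩ := exists_nat_one_div_lt hδ
  set M : ℕ := m + 1 with hM
  have hM0 : (0 : ℝ) < M := by positivity
  let p : (ι → ℕ) → ι → ℝ := fun v i => v i / M
  obtain ⟨v, hv, hw⟩ := kuhn_lemma (m := M)
    -- The label records the sign of the displacement; `v i ≠ 0` forces label 0 on the lower facet
    -- even where `f` fixes coordinate `i`.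
    (a := fun i v => if v i ≠ 0 ∧ f (p v) i ≤ p v i then 1 else 0)
    (fun i v h => by simp [h]) (fun i v h => by
      have h1 : p v i = 1 := by simp only [p, h]; exact div_self hM0.ne'
      have h2 : f (p v) i ≤ 1 := (hmem (p v)).2 i
      rw [if_pos ⟨by omega, by rw [h1]; exact h2⟩])
  have hpmem : ∀ w : ι → ℕ, (∀ j, w j ≤ M) → p w ∈ Set.Icc (0 : ι → ℝ) 1 := by
    intro w hw
    refine ⟨fun j => by simp only [p, Pi.zero_apply]; positivity, fun j => ?_⟩
    simp only [p, Pi.one_apply]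
    rw [div_le_one hM0]
    exact_mod_cast hw j
  have hclose : ∀ w : ι → ℕ, (∀ j, v j ≤ w j ∧ w j ≤ v j + 1) → ∀ i,
      |(f (p v) i - p v i) - (f (p w) i - p w i)| < ε := by
    intro w hw i
    have hd : dist (p v) (p w) < δ := by
      refine lt_of_le_of_lt ((dist_pi_le_iff (by positivity)).2 fun j => ?_) hm
      have h1 : (v j : ℝ) ≤ w j := by exact_mod_cast (hw j).1
      have h2 : (w j : ℝ) ≤ v j + 1 := by exact_mod_cast (hw j).2
      rw [Real.dist_eq, abs_sub_comm]
      simp only [p]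
      rw [← sub_div, abs_of_nonneg (div_nonneg (by linarith) hM0.le)]
      have : ((m : ℝ) + 1) = M := by simp [hM]
      rw [this]
      gcongr
      linarith
    have h := hfδ (p v) (hpmem v fun j => (hv j).le) (p w)
      (hpmem w fun j => (hw j).2.trans (hv j)) hd
    have h' := (dist_le_pi_dist (f (p v) - p v) (f (p w) - p w) i).trans_lt h
    rwa [Real.dist_eq] at h'
  -- Each coordinate of the displacement changes sign on the small cube, so at `p v` it is at most
  -- `ε`, half the assumed minimum.
  have hle : dist (f (p v)) (p v) ≤ ε := by
    refine (dist_pi_le_iff (by positivity)).2 fun i => ?_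
    obtain ⟨w, w', h1, h2, hww⟩ := hw i
    rw [Real.dist_eq, abs_le]
    wlog hc : w i ≠ 0 ∧ f (p w) i ≤ p w i generalizing w w'
    · refine this w' w h2 h1 hww.symm ?_
      by_contra hc'
      simp [hc, hc'] at hww
    have hc' : ¬ (w' i ≠ 0 ∧ f (p w') i ≤ p w' i) := by
      intro hc'
      simp [hc, hc'] at hww
    have hw' : p w' i ≤ f (p w') i := by
      by_cases h0 : w' i = 0
      · have : p w' i = 0 := by simp [p, h0]
        rw [this]
        exact (hmem (p w')).1 i
      · exact (not_le.1 fun h => hc' ⟨h0, h⟩).le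
    have e1 := abs_lt.1 (hclose w h1 i)
    have e2 := abs_lt.1 (hclose w' h2 i)
    constructor <;> linarith [hc.2]
  have := isMinOn_iff.1 hmin _ (hpmem v fun j => (hv j).le)
  linarith

end Kuhn

/-! ### Locally constant choices on a compact set -/

/-- If every connected component of a compact set `W` misses one of the closed sets `A e`, such an
`e` can be chosen in a locally constant way. -/
theorem exists_isLocallyConstant_notMem {α E : Type*} [TopologicalSpace α] [T2Space α]
    {W : Set α} (hW : IsCompact W) (A : E → Set α) (hA : ∀ e, IsClosed (A e))
    (h : ∀ x ∈ W, ∃ e, Disjoint (connectedComponentIn W x) (A e)) :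
    ∃ ε : W → E, IsLocallyConstant ε ∧ ∀ w : W, (w : α) ∉ A (ε w) := by
  classical
  have : CompactSpace W := isCompact_iff_compactSpace.1 hW
  rcases isEmpty_or_nonempty W with hE | ⟨⟨w₀, hw₀⟩⟩
  · exact ⟨fun w => (hE.false w).elim, IsLocallyConstant.of_discrete _,
      fun w => (hE.false w).elim⟩
  obtain ⟨e₀, -⟩ := h w₀ hw₀
  have key : ∃ K : Set W, Set.univ ⊆ K ∧ IsClopen K ∧ ∃ ε : W → E, IsLocallyConstant ε ∧
      ∀ w ∈ K, (w : α) ∉ A (ε w) := by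
    refine (isCompact_univ (X := W)).induction_on
      (p := fun s => ∃ K : Set W, s ⊆ K ∧ IsClopen K ∧ ∃ ε : W → E, IsLocallyConstant ε ∧
        ∀ w ∈ K, (w : α) ∉ A (ε w)) ?_ ?_ ?_ ?_
    · exact ⟨∅, subset_rfl, isClopen_empty, fun _ => e₀, IsLocallyConstant.const e₀, by simp⟩
    · rintro s t hst ⟨K, hK, h⟩
      exact ⟨K, hst.trans hK, h⟩
    · rintro s t ⟨K, hs, hK, ε, hε, hεK⟩ ⟨K', ht, hK', ε', hε', hεK'⟩
      refine ⟨K ∪ K', Set.union_subset_union hs ht, hK.union hK',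
        fun w => if w ∈ K then ε w else ε' w, ?_, ?_⟩
      · refine (IsLocallyConstant.iff_eventually_eq _).2 fun w => ?_
        by_cases hw : w ∈ K
        · filter_upwards [hK.isOpen.mem_nhds hw, hε.eventually_eq w] with y hy hy'
          simp [hy, hw, hy']
        · filter_upwards [hK.compl.isOpen.mem_nhds hw, hε'.eventually_eq w] with y hy hy'
          have hy : y ∉ K := hy
          simp [hy, hw, hy']
      · intro w hw
        by_cases hwK : w ∈ K
        · simpa [hwK] using hεK w hwK
        · simpa [hwK] using hεK' w (hw.resolve_left hwK)
    · intro x _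
      obtain ⟨e, he⟩ := h x x.2
      -- In a compact Hausdorff space components are quasi-components, so by compactness one clopen
      -- neighbourhood of `x` already misses `A e`.
      have hdis : ⋂ s : { s : Set W // IsClopen s ∧ x ∈ s }, (s : Set W) ⊆
          (Subtype.val ⁻¹' A e)ᶜ := by
        rw [← connectedComponent_eq_iInter_isClopen]
        intro y hy hyA
        rw [connectedComponentIn_eq_image x.2] at he
        exact Set.disjoint_left.1 he ⟨y, hy, rfl⟩ hyA
      have : Nonempty { s : Set W // IsClopen s ∧ x ∈ s } :=
        ⟨⟨Set.univ, isClopen_univ, Set.mem_univ x⟩⟩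
      obtain ⟨K, hK⟩ := exists_subset_nhds_of_isCompact'
        (V := fun s : { s : Set W // IsClopen s ∧ x ∈ s } => (s : Set W))
        (fun s t => ⟨⟨s ∩ t, s.2.1.inter t.2.1, s.2.2, t.2.2⟩, Set.inter_subset_left,
          Set.inter_subset_right⟩)
        (fun s => s.2.1.isClosed.isCompact) (fun s => s.2.1.isClosed)
        (fun y hy => ((hA e).preimage continuous_subtype_val).isOpen_compl.mem_nhds (hdis hy))
      exact ⟨K, mem_nhdsWithin_of_mem_nhds (K.2.1.isOpen.mem_nhds K.2.2), K, subset_rfl, K.2.1,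
        fun _ => e, IsLocallyConstant.const e, fun w hw => hK hw⟩
  obtain ⟨K, hK, -, ε, hε, hεK⟩ := key
  exact ⟨ε, hε, fun w => hεK w (hK (Set.mem_univ w))⟩

/-! ### Regrouping a cover of bounded multiplicity -/

theorem exists_continuous_zero_one_of_disjoint_open {α : Type*} [TopologicalSpace α]
    [NormalSpace α] {C P N : Set α} (hC : IsClosed C) (hP : IsOpen P) (hN : IsOpen N)
    (hPN : Disjoint P N) (hCPN : C ⊆ P ∪ N) :
    ∃ φ : C(α, ℝ), (∀ x, φ x ∈ Set.Icc (0 : ℝ) 1) ∧ (∀ x ∈ C ∩ P, φ x = 0) ∧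
      ∀ x ∈ C ∩ N, φ x = 1 := by
  obtain ⟨φ, h0, h1, h⟩ := exists_continuous_zero_one_of_isClosed (s := C \ N) (t := C \ P)
    (hC.sdiff hN) (hC.sdiff hP) (Set.disjoint_left.2 fun x hx hx' =>
      (hCPN hx.1).elim hx'.2 hx.2)
  exact ⟨φ, h, fun x hx => h0 ⟨hx.1, fun h => Set.disjoint_left.1 hPN hx.2 h⟩,
    fun x hx => h1 ⟨hx.1, fun h => Set.disjoint_left.1 hPN h hx.2⟩⟩

/-- The set of points at which the functions `f i` with `i ∈ S` are positive and exceed all the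
others. -/
def dominanceSet {α ι : Type*} (f : ι → α → ENNReal) (S : Finset ι) : Set α :=
  {x | ∀ i ∈ S, 0 < f i x ∧ ∀ j, j ∉ S → f j x < f i x}

theorem isOpen_dominanceSet {α ι : Type*} [TopologicalSpace α] [Finite ι] {f : ι → α → ENNReal}
    (hf : ∀ i, Continuous (f i)) (S : Finset ι) : IsOpen (dominanceSet f S) := by
  simp only [dominanceSet, Set.ofPred_forall, Set.ofPred_and]
  refine isOpen_biInter_finset fun i _ => (isOpen_lt continuous_const (hf i)).inter
    (isOpen_iInter_of_finite fun j => isOpen_iInter_of_finite fun _ => isOpen_lt (hf j) (hf i))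

/-- Distinct sets of equal size each have an element outside the other, and each of these two would
have to dominate the other. -/
theorem eq_of_mem_dominanceSet {α ι : Type*} {f : ι → α → ENNReal} {S S' : Finset ι}
    (hcard : S.card = S'.card) {x : α} (hx : x ∈ dominanceSet f S)
    (hx' : x ∈ dominanceSet f S') : S = S' := by
  by_contra hne
  have h1 : ¬ S ⊆ S' := fun h => hne (Finset.eq_of_subset_of_card_le h hcard.ge)
  have h2 : ¬ S' ⊆ S := fun h => hne (Finset.eq_of_subset_of_card_le h hcard.le).symm
  obtain ⟨i, hi, hi'⟩ := Finset.not_subset.1 h1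
  obtain ⟨j, hj, hj'⟩ := Finset.not_subset.1 h2
  exact lt_asymm ((hx i hi).2 j hj') ((hx' j hj).2 i hi')

/-- A finite open cover of multiplicity at most `k` of a closed set splits into `k` families of
pairwise disjoint sets, and each family can be separated by a function into the sets inside some
`U i` with `i ∈ A c` and the sets inside some `U i` with `i ∉ A c`. -/
theorem exists_separating_functions {α ι : Type*} [MetricSpace α] [Finite ι] {U : ι → Set α}
    (hU : ∀ i, IsOpen (U i)) {T : Set α} (hT : IsClosed T) (hTU : T ⊆ ⋃ i, U i) {k : ℕ}
    (hmult : ∀ x ∈ T, {i | x ∈ U i}.encard ≤ k) (A : Fin k → Set ι) :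
    ∃ φ : Fin k → C(α, ℝ), (∀ c x, φ c x ∈ Set.Icc (0 : ℝ) 1) ∧
      ∀ x ∈ T, ∃ c, (φ c x = 0 ∧ ∃ i ∈ A c, x ∈ U i) ∨ (φ c x = 1 ∧ ∃ i ∉ A c, x ∈ U i) := by
  classical
  have := Fintype.ofFinite ι
  -- With extended distances, `U i = univ` is harmless: the distance to the empty set is `⊤`, still
  -- positive.
  let f : ι → α → ENNReal := fun i x => Metric.infEDist x (U i)ᶜ
  have hf : ∀ i, Continuous (f i) := fun i => Metric.continuous_infEDist
  have hfU : ∀ i x, 0 < f i x ↔ x ∈ U i := fun i x => by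
    rw [pos_iff_ne_zero, ne_eq, ← Metric.mem_closure_iff_infEDist_zero,
      (hU i).isClosed_compl.closure_eq, Set.mem_compl_iff, not_not]
  let P : Fin k → Set α := fun c =>
    ⋃ S : {S : Finset ι // S.card = c + 1 ∧ ∃ i ∈ S, i ∈ A c}, dominanceSet f S
  let N : Fin k → Set α := fun c =>
    ⋃ S : {S : Finset ι // S.card = c + 1 ∧ ¬ ∃ i ∈ S, i ∈ A c}, dominanceSet f S
  have hP : ∀ c, IsOpen (P c) := fun c => isOpen_iUnion fun S => isOpen_dominanceSet hf S
  have hN : ∀ c, IsOpen (N c) := fun c => isOpen_iUnion fun S => isOpen_dominanceSet hf S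
  have hPN : ∀ c, Disjoint (P c) (N c) := by
    intro c
    refine Set.disjoint_left.2 fun x hx hx' => ?_
    obtain ⟨S, hS⟩ := Set.mem_iUnion.1 hx
    obtain ⟨S', hS'⟩ := Set.mem_iUnion.1 hx'
    have := eq_of_mem_dominanceSet (S.2.1.trans S'.2.1.symm) hS hS'
    exact S'.2.2 (this ▸ S.2.2)
  have hPU : ∀ c, ∀ x ∈ P c, ∃ i ∈ A c, x ∈ U i := by
    intro c x hx
    obtain ⟨⟨S, _, i, hi, hiA⟩, hS⟩ := Set.mem_iUnion.1 hx
    exact ⟨i, hiA, (hfU i x).1 (hS i hi).1⟩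
  have hNU : ∀ c, ∀ x ∈ N c, ∃ i ∉ A c, x ∈ U i := by
    intro c x hx
    obtain ⟨⟨S, hcard, hSA⟩, hS⟩ := Set.mem_iUnion.1 hx
    obtain ⟨i, hi⟩ := Finset.card_pos.1 (hcard ▸ Nat.succ_pos (c : ℕ) : 0 < S.card)
    exact ⟨i, fun h => hSA ⟨i, hi, h⟩, (hfU i x).1 (hS i hi).1⟩
  have hcov : T ⊆ ⋃ c, P c ∪ N c := by
    intro x hx
    obtain ⟨i₀, hi₀⟩ := Set.mem_iUnion.1 (hTU hx)
    obtain ⟨i₁, -, hi₁⟩ := Finset.exists_max_image Finset.univ (fun i => f i x)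
      ⟨i₀, Finset.mem_univ i₀⟩
    have hpos : 0 < f i₁ x := ((hfU i₀ x).2 hi₀).trans_le (hi₁ i₀ (Finset.mem_univ i₀))
    -- The indices of maximal distance dominate all others; their number, between 1 and `k`, gives
    -- the level.
    let S : Finset ι := Finset.univ.filter fun i => f i x = f i₁ x
    have hS : x ∈ dominanceSet f S := by
      intro i hi
      have hi : f i x = f i₁ x := by simpa [S] using hi
      refine ⟨hi ▸ hpos, fun j hj => ?_⟩
      have hj : f j x ≠ f i₁ x := by simpa [S] using hj
      exact hi ▸ lt_of_le_of_ne (hi₁ j (Finset.mem_univ j)) hj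
    have hSpos : 0 < S.card := Finset.card_pos.2 ⟨i₁, by simp [S]⟩
    have hSk : S.card ≤ k := by
      have h1 : (S : Set ι) ⊆ {i | x ∈ U i} := fun i hi => (hfU i x).1 (hS i hi).1
      have h2 := (Set.encard_le_encard h1).trans (hmult x hx)
      rw [Set.encard_coe_eq_coe_finsetCard] at h2
      exact_mod_cast h2
    refine Set.mem_iUnion.2 ⟨⟨S.card - 1, by omega⟩, ?_⟩
    have hc : S.card = S.card - 1 + 1 := by omega
    by_cases hSA : ∃ i ∈ S, i ∈ A ⟨S.card - 1, by omega⟩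
    · exact Or.inl (Set.mem_iUnion.2 ⟨⟨S, hc, hSA⟩, hS⟩)
    · exact Or.inr (Set.mem_iUnion.2 ⟨⟨S, hc, hSA⟩, hS⟩)
  -- `P c` and `N c` may have touching closures, so the cover is shrunk to closed sets before
  -- Urysohn's lemma is applied.
  obtain ⟨C, hTC, hC, hCPN⟩ := exists_subset_iUnion_closed_subset hT
    (fun c => (hP c).union (hN c)) (fun x _ => Set.toFinite _) hcov
  choose φ hφ h0 h1 using fun c => exists_continuous_zero_one_of_disjoint_open (hC c) (hP c)
    (hN c) (hPN c) (hCPN c)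
  refine ⟨φ, hφ, fun x hx => ?_⟩
  obtain ⟨c, hc⟩ := Set.mem_iUnion.1 (hTC hx)
  refine ⟨c, (hCPN c hc).imp (fun h => ⟨h0 c x ⟨hc, h⟩, hPU c x h⟩)
    (fun h => ⟨h1 c x ⟨hc, h⟩, hNU c x h⟩)⟩

/-! ### The open case -/

/-- The face of the unit cube on which the coordinates from `k` on agree with `v`. -/
def tailFace {n : ℕ} (k : ℕ) (v : Fin n → ℝ) : Set (Fin n → ℝ) :=
  {x ∈ unitCube n | ∀ j : Fin n, k ≤ j → x j = v j}

theorem isClosed_tailFace {n : ℕ} (k : ℕ) (v : Fin n → ℝ) : IsClosed (tailFace k v) := by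
  simp only [tailFace, Set.ofPred_and, Set.ofPred_forall]
  exact isClosed_Icc.inter (isClosed_iInter fun j => isClosed_iInter fun _ =>
    isClosed_eq (continuous_apply j) continuous_const)

theorem exists_component_of_isOpen {n k : ℕ} (hk : k ≤ n) {ι : Type*} {X : ι → Set (Fin n → ℝ)}
    (hopen : ∀ i, IsOpenInCube (X i))
    (hfacet : ∀ i j, ¬ ((X i ∩ lowerFacet j).Nonempty ∧ (X i ∩ upperFacet j).Nonempty))
    (hmult : ∀ x, {i | x ∈ X i}.encard ≤ k) :
    ∃ x ∈ unitCube n \ ⋃ i, X i, ∀ v : Fin n → ℝ, (∀ j, v j = 0 ∨ v j = 1) →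
      (connectedComponentIn (unitCube n \ ⋃ i, X i) x ∩ tailFace k v).Nonempty := by
  classical
  choose U hU hXU using hopen
  have hcube : IsCompact (unitCube n) := isCompact_Icc
  set W := unitCube n \ ⋃ i, X i with hW
  have hWU : W = unitCube n \ ⋃ i, U i := by
    ext x
    simp only [hW, hXU, Set.mem_sdiff, Set.mem_iUnion, Set.mem_inter_iff, not_exists, not_and]
    exact ⟨fun h => ⟨h.1, fun i => h.2 i h.1⟩, fun h => ⟨h.1, fun i _ => h.2 i⟩⟩
  have hWc : IsCompact W := hWU ▸ hcube.diff (isOpen_iUnion hU)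
  by_contra! hcon
  obtain ⟨ε, hε, hεW⟩ := exists_isLocallyConstant_notMem hWc
    (fun v : {v : Fin n → ℝ // ∀ j, v j = 0 ∨ v j = 1} => tailFace k v.1)
    (fun v => isClosed_tailFace k v.1) (fun x hx => by
      obtain ⟨v, hv, h⟩ := hcon x hx
      exact ⟨⟨v, hv⟩, Set.disjoint_iff_inter_eq_empty.2 h⟩)
  have hext : ∀ j, ∃ e : C(Fin n → ℝ, ℝ), (∀ x, e x ∈ Set.Icc (0 : ℝ) 1) ∧
      ∀ w : W, e w = (ε w).1 j := by
    intro j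
    obtain ⟨e, he, her⟩ := ContinuousMap.exists_restrict_eq_forall_mem_of_closed
      (s := W) (t := Set.Icc (0 : ℝ) 1)
      ⟨fun w => (ε w).1 j, (hε.comp fun v => v.1 j).continuous⟩
      (fun w => by rcases (ε w).2 j with h | h <;> simp [h]) ⟨0, by simp⟩ hWc.isClosed
    exact ⟨e, he, fun w => DFunLike.congr_fun her w⟩
  choose e he heW using hext
  let T : Set (Fin n → ℝ) := unitCube n ∩ {x | ∀ j : Fin n, k ≤ j → x j = e j x}
  have hT : IsCompact T := by
    refine hcube.inter_right ?_
    simp only [Set.ofPred_forall]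
    exact isClosed_iInter fun j => isClosed_iInter fun _ =>
      isClosed_eq (continuous_apply j) (e j).continuous
  have hTU : T ⊆ ⋃ i, U i := by
    intro x hx
    by_contra hxU
    have hxW : x ∈ W := hWU ▸ ⟨hx.1, hxU⟩
    exact hεW ⟨x, hxW⟩ ⟨hx.1, fun j hj => (hx.2 j hj).trans (heW j ⟨x, hxW⟩)⟩
  obtain ⟨s, hs⟩ := hT.elim_finite_subcover U hU hTU
  obtain ⟨φ, hφ, hφT⟩ := exists_separating_functions (U := fun i : s => U i) (fun i => hU i)
    hT.isClosed (by simpa [Set.iUnion_subtype] using hs) (k := k) (fun x hx => by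
      have h1 : (Subtype.val '' {i : s | x ∈ U i}) ⊆ {i | x ∈ X i} := by
        rintro _ ⟨i, hi, rfl⟩
        exact (hXU i).ge ⟨hx.1, hi⟩
      rw [← Subtype.val_injective.encard_image]
      exact (Set.encard_le_encard h1).trans (hmult x))
    -- Indices outside this set meet the lower facet, so by `hfacet` they miss the upper one.
    (fun c => {i | ¬ (X i ∩ lowerFacet (Fin.castLE hk c)).Nonempty})
  obtain ⟨x, hx⟩ := exists_fixed_point_of_mem_Icc
    (f := fun x (j : Fin n) => if h : (j : ℕ) < k then φ ⟨j, h⟩ x else e j x)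
    (continuous_pi fun j => by split_ifs <;> fun_prop)
    (fun x => ⟨fun j => by
      dsimp only [Pi.zero_apply]; split_ifs; exacts [(hφ _ x).1, (he _ x).1],
      fun j => by dsimp only [Pi.one_apply]; split_ifs; exacts [(hφ _ x).2, (he _ x).2]⟩)
  have hxφ : ∀ c : Fin k, φ c x = x (Fin.castLE hk c) := fun c => by
    have := congrFun hx (Fin.castLE hk c)
    simpa using this
  have hxe : ∀ j : Fin n, k ≤ j → x j = e j x := fun j hj => by
    have := congrFun hx j
    rw [dif_neg (not_lt.2 hj)] at this
    exact this.symm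
  have hxQ : x ∈ unitCube n := by
    rw [← hx]
    exact ⟨fun j => by
      dsimp only [Pi.zero_apply]; split_ifs; exacts [(hφ _ x).1, (he _ x).1],
      fun j => by dsimp only [Pi.one_apply]; split_ifs; exacts [(hφ _ x).2, (he _ x).2]⟩
  obtain ⟨c, ⟨hc, i, hi, hxi⟩ | ⟨hc, i, hi, hxi⟩⟩ := hφT x ⟨hxQ, hxe⟩
  · exact hi ⟨x, (hXU i).ge ⟨hxQ, hxi⟩, hxQ, (hxφ c).symm.trans hc⟩
  · exact hfacet i _ ⟨not_not.1 hi, x, (hXU i).ge ⟨hxQ, hxi⟩, hxQ, (hxφ c).symm.trans hc⟩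

/-! ### Reduction of the closed case to the open case -/

/-- Small balls around the points of a compact set meet no more members of a finite closed family
than contain some common point. -/
theorem exists_pos_forall_ball_inter {α κ : Type*} [PseudoMetricSpace α] [Finite κ] {K : Set α}
    (hK : IsCompact K) {C : κ → Set α} (hC : ∀ i, IsClosed (C i)) :
    ∃ δ > 0, ∀ z ∈ K, ∃ y, ∀ i, (Metric.ball z δ ∩ C i).Nonempty → y ∈ C i := by
  obtain ⟨δ, hδ, h⟩ := lebesgue_number_lemma_of_metric hK
    -- The open set attached to `y` avoids every member not containing `y`.
    (c := fun y : α => (⋃ i : {i // y ∉ C i}, C i)ᶜ)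
    (fun y => (isClosed_iUnion_of_finite fun i : {i // y ∉ C i} => hC i).isOpen_compl)
    (fun y _ => Set.mem_iUnion.2 ⟨y, by simp⟩)
  refine ⟨δ, hδ, fun z hz => ?_⟩
  obtain ⟨y, hy⟩ := h z hz
  refine ⟨y, fun i ⟨w, hw, hwi⟩ => ?_⟩
  by_contra hyi
  exact hy hw (Set.mem_iUnion.2 ⟨⟨i, hyi⟩, hwi⟩)

theorem isClosed_lowerFacet {n : ℕ} (j : Fin n) : IsClosed (lowerFacet j) :=
  isClosed_Icc.inter (isClosed_eq (continuous_apply j) continuous_const)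

theorem isClosed_upperFacet {n : ℕ} (j : Fin n) : IsClosed (upperFacet j) :=
  isClosed_Icc.inter (isClosed_eq (continuous_apply j) continuous_const)

theorem exists_component_of_isClosed {n k : ℕ} (hk : k ≤ n) {ι : Type*} [Finite ι]
    {X : ι → Set (Fin n → ℝ)} (hsub : ∀ i, X i ⊆ unitCube n) (hclosed : ∀ i, IsClosed (X i))
    (hfacet : ∀ i j, ¬ ((X i ∩ lowerFacet j).Nonempty ∧ (X i ∩ upperFacet j).Nonempty))
    (hmult : ∀ x, {i | x ∈ X i}.encard ≤ k) :
    ∃ x ∈ unitCube n \ ⋃ i, X i, ∀ v : Fin n → ℝ, (∀ j, v j = 0 ∨ v j = 1) →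
      (connectedComponentIn (unitCube n \ ⋃ i, X i) x ∩ tailFace k v).Nonempty := by
  obtain ⟨δ, hδ, hball⟩ := exists_pos_forall_ball_inter (K := unitCube n) isCompact_Icc
    -- The facets join the family so that one `δ` controls both the multiplicity and the facets met
    -- by the thickened sets.
    (C := Sum.elim X (Sum.elim lowerFacet upperFacet)) (by
      rintro (i | j | j)
      exacts [hclosed i, isClosed_lowerFacet j, isClosed_upperFacet j])
  let Y : ι → Set (Fin n → ℝ) := fun i => unitCube n ∩ Metric.thickening δ (X i)
  have hYball : ∀ i, ∀ z ∈ Y i, (Metric.ball z δ ∩ X i).Nonempty := by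
    intro i z hz
    obtain ⟨w, hw, hzw⟩ := Metric.mem_thickening_iff.1 hz.2
    exact ⟨w, by rwa [Metric.mem_ball, dist_comm], hw⟩
  have hsub' : unitCube n \ ⋃ i, Y i ⊆ unitCube n \ ⋃ i, X i :=
    Set.sdiff_subset_sdiff_right (Set.iUnion_mono fun i x hx =>
      ⟨hsub i hx, Metric.self_subset_thickening hδ _ hx⟩)
  obtain ⟨x, hx, h⟩ := exists_component_of_isOpen (X := Y) hk
    (fun i => ⟨_, Metric.isOpen_thickening, rfl⟩) (by
      rintro i j ⟨⟨z, hz, hzj⟩, w, hw, hwj⟩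
      obtain ⟨y, hy⟩ := hball z hz.1
      obtain ⟨y', hy'⟩ := hball w hw.1
      exact hfacet i j
        ⟨⟨y, hy (.inl i) (hYball i z hz),
          hy (.inr (.inl j)) ⟨z, Metric.mem_ball_self hδ, hzj⟩⟩,
        ⟨y', hy' (.inl i) (hYball i w hw),
          hy' (.inr (.inr j)) ⟨w, Metric.mem_ball_self hδ, hwj⟩⟩⟩) (by
      intro z
      by_cases hz : z ∈ unitCube n
      · obtain ⟨y, hy⟩ := hball z hz
        exact (Set.encard_le_encard fun i hi => hy (.inl i) (hYball i z hi)).trans (hmult y)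
      · have : {i | z ∈ Y i} = ∅ := Set.eq_empty_of_forall_notMem fun i hi => hz hi.1
        simp [this])
  exact ⟨x, hsub' hx, fun v hv => (h v hv).mono
    (Set.inter_subset_inter_left _ (connectedComponentIn_mono x hsub'))⟩

/-! ### Coordinate subspaces and parallel faces -/

theorem finrank_span_single {n : ℕ} (I : Finset (Fin n)) :
    Module.finrank ℝ (Submodule.span ℝ
      ((fun j => Pi.single j (1 : ℝ) : Fin n → Fin n → ℝ) '' (I : Set (Fin n)))) = I.card := by
  have hli : LinearIndependent ℝ (fun j => Pi.single j (1 : ℝ) : Fin n → Fin n → ℝ) := by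
    convert (Pi.basisFun ℝ (Fin n)).linearIndependent with j
    simp
  rw [Set.image_eq_range]
  exact (finrank_span_eq_card (hli.comp _ Subtype.val_injective)).trans (by simp)

/-- Directions in the span of a cube face are free directions of the face. -/
theorem mem_of_single_mem_vectorSpan {n : ℕ} {I : Finset (Fin n)} {v : Fin n → ℝ} {j : Fin n}
    (h : Pi.single j (1 : ℝ) ∈
      vectorSpan ℝ {x ∈ unitCube n | ∀ j, j ∉ I → x j = v j}) : j ∈ I := by
  by_contra hj
  have hle : vectorSpan ℝ {x ∈ unitCube n | ∀ j, j ∉ I → x j = v j} ≤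
      LinearMap.ker (LinearMap.proj j : (Fin n → ℝ) →ₗ[ℝ] ℝ) := by
    refine Submodule.span_le.2 ?_
    rintro _ ⟨x, hx, y, hy, rfl⟩
    simp [hx.2 j hj, hy.2 j hj]
  simpa using hle h

theorem mainTheorem4 (n k : ℕ) (hk : k ≤ n) {ι : Type*} (X : ι → Set (Fin n → ℝ))
    (hsub : ∀ i, X i ⊆ unitCube n)
    (htop : (∀ i, IsOpenInCube (X i)) ∨ (Finite ι ∧ ∀ i, IsClosed (X i)))
    (hfacet : ∀ i j, ¬ ((X i ∩ lowerFacet j).Nonempty ∧ (X i ∩ upperFacet j).Nonempty))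
    (hmult : ∀ x, {i | x ∈ X i}.encard ≤ k) :
    ∃ (Z : Set (Fin n → ℝ)) (L : Submodule ℝ (Fin n → ℝ)),
      IsConnectedComponentOf Z (unitCube n \ ⋃ i, X i) ∧
      IsCoordinateSubspace L ∧ Module.finrank ℝ L = k ∧
      ∀ F : Set (Fin n → ℝ), IsCubeFace F → vectorSpan ℝ F = L → (Z ∩ F).Nonempty := by
  obtain ⟨x, hx, h⟩ : ∃ x ∈ unitCube n \ ⋃ i, X i, ∀ v : Fin n → ℝ, (∀ j, v j = 0 ∨ v j = 1) →
      (connectedComponentIn (unitCube n \ ⋃ i, X i) x ∩ tailFace k v).Nonempty := by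
    rcases htop with hopen | ⟨hfin, hclosed⟩
    · exact exists_component_of_isOpen hk hopen hfacet hmult
    · exact exists_component_of_isClosed hk hsub hclosed hfacet hmult
  let I : Finset (Fin n) := Finset.univ.map (Fin.castLEEmb hk)
  have hI : ∀ j : Fin n, (j : ℕ) < k → j ∈ I := fun j hj =>
    Finset.mem_map.2 ⟨⟨j, hj⟩, Finset.mem_univ _, rfl⟩
  refine ⟨_, _, ⟨x, hx, rfl⟩, ⟨I, rfl⟩, by rw [finrank_span_single]; simp [I], ?_⟩
  rintro _ ⟨I', v, hv, rfl⟩ hspan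
  -- The inclusion `I ⊆ I'` suffices: it puts the tail face of `v` inside the given face.
  refine (h v hv).mono (Set.inter_subset_inter_right _ fun y hy => ⟨hy.1, fun j hj => hy.2 j ?_⟩)
  by_contra! hjk
  refine hj (mem_of_single_mem_vectorSpan (v := v) ?_)
  rw [hspan]
  exact Submodule.subset_span ⟨j, hI j hjk, rfl⟩
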